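/- Let $n\ge 0$, let $X\subseteq\mathbb{R}^n$ be open and connected, and let $\Omega=X\times(0,\infty)$. Let $\alpha_{ij},\beta_i,\gamma:\Omega\to\mathbb{R}$ ($1\le i,j\le n$) be functions, not assumed continuous, each bounded on every compact subset of $\Omega$, with $\gamma\ge 0$ in $\Omega$. Suppose that $(\alpha_{ij})$ is locally uniformly positive definite in $\Omega$: for every compact $C\subset\Omega$ there is $\theta>0$ such that $\sum_{i,j}\alpha_{ij}(x,t)\xi_i\xi_j\ge\theta|\xi|^2$ for all $(x,t)\in C$ and $\xi\in\mathbb{R}^n$. Let $f:\overline\Omega\to[0,\infty)$ be continuous and satisfy $$\frac{\partial f}{\partial t}-\sum_{i,j}\alpha_{ij}(x,t)\frac{\partial^2 f}{\partial x_i\partial x_j}-\sum_i\beta_i(x,t)\frac{\partial f}{\partial x_i}+\gamma(x,t)f\ge 0\quad\text{in }\Omega$$ in the viscosity sense, that is: whenever $\psi\in C^\infty(\Omega)$ and $(\hat x,\hat t)\in\Omega$ are such that $\psi(\hat x,\hat t)=f(\hat x,\hat t)$ and $\psi\le f$ in a neighborhood of $(\hat x,\hat t)$, then $$\psi_t-\sum_{i,j}\alpha_{ij}\psi_{x_ix_j}-\sum_i\beta_i\psi_{x_i}+\gamma\psi\ge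 0\quad\text{at }(\hat x,\hat t).$$ If $f(x_0,t_0)=0$ for some $(x_0,t_0)\in\Omega$, then $f(x,t)=0$ for all $(x,t)\in\overline\Omega$ with $t\le t_0$. -/

import Mathlib

open scoped Topology ContDiff

/-- Space-time `ℝⁿ × ℝ`, with points `(x, t)`. -/
abbrev SpaceTime (n : ℕ) : Type := EuclideanSpace ℝ (Fin n) × ℝ

/-- The space-time cylinder `Ω = X × (0, ∞)`. -/
def cylinder {n : ℕ} (X : Set (EuclideanSpace ℝ (Fin n))) : Set (SpaceTime n) :=
  X ×ˢ Set.Ioi (0 : ℝ)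

/-- The partial derivative `∂ψ/∂t`. -/
noncomputable def partialT {n : ℕ} (ψ : SpaceTime n → ℝ) (p : SpaceTime n) : ℝ :=
  lineDeriv ℝ ψ p (0, 1)

/-- The partial derivative `∂ψ/∂xᵢ`. -/
noncomputable def partialX {n : ℕ} (i : Fin n) (ψ : SpaceTime n → ℝ) (p : SpaceTime n) : ℝ :=
  lineDeriv ℝ ψ p (EuclideanSpace.single i 1, 0)

/-- The differential operator without its zeroth order term, applied to a smooth function:
`∂ψ/∂t - ∑ αᵢⱼ ∂²ψ/∂xᵢ∂xⱼ - ∑ βᵢ ∂ψ/∂xᵢ`. -/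
noncomputable def parabolicOp {n : ℕ} (α : SpaceTime n → Matrix (Fin n) (Fin n) ℝ)
    (β : SpaceTime n → Fin n → ℝ) (ψ : SpaceTime n → ℝ) (p : SpaceTime n) : ℝ :=
  partialT ψ p - ∑ i, ∑ j, α p i j * partialX i (partialX j ψ) p - ∑ i, β p i * partialX i ψ p

/-- `ψ` touches `f` from below at `p`. -/
def TouchesFromBelow {n : ℕ} (ψ f : SpaceTime n → ℝ) (p : SpaceTime n) : Prop :=
  ψ p = f p ∧ ∀ᶠ q in 𝓝 p, ψ q ≤ f q

/-- `f_t - ∑ αᵢⱼ f_{xᵢxⱼ} - ∑ βᵢ f_{xᵢ} + γ f ≥ 0` in the open set `Ω` in the viscosity sense: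
the inequality holds, with the pointwise values of the coefficients, for every smooth function
on `Ω` at every point of `Ω` at which it touches `f` from below. -/
def IsViscositySupersolution {n : ℕ} (Ω : Set (SpaceTime n))
    (α : SpaceTime n → Matrix (Fin n) (Fin n) ℝ) (β : SpaceTime n → Fin n → ℝ)
    (γ : SpaceTime n → ℝ) (f : SpaceTime n → ℝ) : Prop :=
  ∀ ψ : SpaceTime n → ℝ, ContDiffOn ℝ ∞ ψ Ω → ∀ p ∈ Ω, TouchesFromBelow ψ f p →
    0 ≤ parabolicOp α β ψ p + γ p * ψ p

/-- `g` is bounded on every compact subset of `Ω`. -/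
def LocallyBoundedIn {n : ℕ} (Ω : Set (SpaceTime n)) (g : SpaceTime n → ℝ) : Prop :=
  ∀ C ⊆ Ω, IsCompact C → ∃ M : ℝ, ∀ p ∈ C, |g p| ≤ M

/-- `α` is uniformly positive definite, as a quadratic form, on every compact subset of `Ω`. -/
def LocallyUniformlyPosDefIn {n : ℕ} (Ω : Set (SpaceTime n))
    (α : SpaceTime n → Matrix (Fin n) (Fin n) ℝ) : Prop :=
  ∀ C ⊆ Ω, IsCompact C → ∃ θ : ℝ, 0 < θ ∧
    ∀ p ∈ C, ∀ ξ : Fin n → ℝ, θ * ∑ i, ξ i ^ 2 ≤ ∑ i, ∑ j, α p i j * ξ i * ξ j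

/-! By contraposition: if `f` is positive at `(y, s)`, it is positive at every `(z, t)` with `z ∈ X`
and `t > s`. For nearby `y` and `z`, follow a ball moving from `y` to `z` at constant velocity and
compare `f` with `g(τ) w²`, where `w = ρ² - |d|²` vanishes on the lateral boundary. Near that
boundary ellipticity makes the operator negative; inside, rapid exponential decay of `g` does
(`exists_decay_rate`). A negative minimum of `f` minus this barrier would be interior, so a shifted
barrier would touch `f` from below and contradict the viscosity inequality
(`pos_of_pos_at_earlier_time`). Connectedness of `X` chains such steps, and continuity handles the
closure. -/

/-- The displacement of `p` from the centre of a ball which starts at `y` at time `s` and moves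
with velocity `v`. -/
noncomputable def displacement {n : ℕ} (y v : EuclideanSpace ℝ (Fin n)) (s : ℝ)
    (p : SpaceTime n) : EuclideanSpace ℝ (Fin n) :=
  p.1 - y - (p.2 - s) • v

/-- A function supported, up to the constant `m`, in a tilted cylinder of radius `ρ`. -/
noncomputable def barrier {n : ℕ} (y v : EuclideanSpace ℝ (Fin n)) (s ρ m : ℝ) (g : ℝ → ℝ)
    (p : SpaceTime n) : ℝ :=
  g p.2 * (ρ ^ 2 - ‖displacement y v s p‖ ^ 2) ^ 2 + m

/-! ### Smoothness and derivatives of the barrier -/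

theorem contDiff_displacement {n : ℕ} (y v : EuclideanSpace ℝ (Fin n)) (s : ℝ) :
    ContDiff ℝ ∞ (displacement y v s) := by
  unfold displacement
  fun_prop

theorem contDiff_barrier {n : ℕ} (y v : EuclideanSpace ℝ (Fin n)) (s ρ m : ℝ) {g : ℝ → ℝ}
    (hg : ContDiff ℝ ∞ g) : ContDiff ℝ ∞ (barrier y v s ρ m g) := by
  have h := (contDiff_displacement y v s).norm_sq ℝ
  exact ((hg.comp contDiff_snd).mul ((contDiff_const.sub h).pow 2)).add contDiff_const

theorem hasDerivAt_displacement_line {n : ℕ} (y v : EuclideanSpace ℝ (Fin n)) (s : ℝ)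
    (p : SpaceTime n) (e : EuclideanSpace ℝ (Fin n)) (σ : ℝ) :
    HasDerivAt (fun r : ℝ => displacement y v s (p + r • (e, σ))) (e - σ • v) 0 := by
  have h : (fun r : ℝ => displacement y v s (p + r • (e, σ))) =
      fun r : ℝ => displacement y v s p + r • (e - σ • v) := by
    funext r
    simp only [displacement, Prod.fst_add, Prod.snd_add, Prod.smul_fst, Prod.smul_snd,
      smul_eq_mul]
    module
  rw [h]
  simpa using ((hasDerivAt_id (0 : ℝ)).smul_const (e - σ • v)).const_add (displacement y v s p)

theorem hasDerivAt_height_line {n : ℕ} (y v : EuclideanSpace ℝ (Fin n)) (s ρ : ℝ)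
    (p : SpaceTime n) (e : EuclideanSpace ℝ (Fin n)) (σ : ℝ) :
    HasDerivAt (fun r : ℝ => ρ ^ 2 - ‖displacement y v s (p + r • (e, σ))‖ ^ 2)
      (-(2 * inner ℝ (displacement y v s p) (e - σ • v))) 0 := by
  simpa using ((hasDerivAt_displacement_line y v s p e σ).norm_sq).const_sub (ρ ^ 2)

theorem hasDerivAt_time_line {n : ℕ} {g : ℝ → ℝ} {g' : ℝ} (p : SpaceTime n)
    (hg : HasDerivAt g g' p.2) (e : EuclideanSpace ℝ (Fin n)) (σ : ℝ) :
    HasDerivAt (fun r : ℝ => g (p + r • (e, σ)).2) (g' * σ) 0 := by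
  have h : HasDerivAt (fun r : ℝ => (p + r • (e, σ)).2) σ 0 := by
    simpa using ((hasDerivAt_id (0 : ℝ)).mul_const σ).const_add p.2
  refine HasDerivAt.comp (0 : ℝ) (h₂ := g) ?_ h
  simpa using hg

theorem partialT_barrier {n : ℕ} (y v : EuclideanSpace ℝ (Fin n)) (s ρ m : ℝ) {g : ℝ → ℝ}
    {g' : ℝ} (p : SpaceTime n) (hg : HasDerivAt g g' p.2) :
    partialT (barrier y v s ρ m g) p =
      g' * (ρ ^ 2 - ‖displacement y v s p‖ ^ 2) ^ 2 +
        4 * g p.2 * (ρ ^ 2 - ‖displacement y v s p‖ ^ 2) *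
          inner ℝ (displacement y v s p) v := by
  have h := ((hasDerivAt_time_line p hg 0 1).mul
    ((hasDerivAt_height_line y v s ρ p 0 1).pow 2)).add_const m
  refine Eq.trans (HasDerivAt.deriv h) ?_
  have hp : p + ((0 : EuclideanSpace ℝ (Fin n)), (0 : ℝ)) = p := add_zero p
  simp [hp]
  ring

theorem partialX_barrier {n : ℕ} (y v : EuclideanSpace ℝ (Fin n)) (s ρ m : ℝ) {g : ℝ → ℝ}
    (hg : Differentiable ℝ g) (j : Fin n) :
    partialX j (barrier y v s ρ m g) = fun p =>
      -4 * (g p.2 * ((ρ ^ 2 - ‖displacement y v s p‖ ^ 2) * displacement y v s p j)) := by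
  funext p
  have h := ((hasDerivAt_time_line p (hg p.2).hasDerivAt (EuclideanSpace.single j 1) 0).mul
    ((hasDerivAt_height_line y v s ρ p (EuclideanSpace.single j 1) 0).pow 2)).add_const m
  refine Eq.trans (HasDerivAt.deriv h) ?_
  simp [EuclideanSpace.inner_single_right]
  ring

theorem partialX_partialX_barrier {n : ℕ} (y v : EuclideanSpace ℝ (Fin n)) (s ρ m : ℝ)
    {g : ℝ → ℝ} (hg : Differentiable ℝ g) (i j : Fin n) (p : SpaceTime n) :
    partialX i (partialX j (barrier y v s ρ m g)) p =
      8 * g p.2 * (displacement y v s p i * displacement y v s p j) -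
        4 * g p.2 * (ρ ^ 2 - ‖displacement y v s p‖ ^ 2) * (if i = j then 1 else 0) := by
  rw [partialX_barrier y v s ρ m hg j]
  have hd : HasDerivAt (fun r : ℝ => displacement y v s (p + r • (EuclideanSpace.single i 1, 0)) j)
      (if i = j then 1 else 0) 0 := by
    have := (hasDerivAt_pi.1 ((EuclideanSpace.equiv (Fin n) ℝ).hasFDerivAt.comp_hasDerivAt (0 : ℝ)
      (hasDerivAt_displacement_line y v s p (EuclideanSpace.single i 1) 0))) j
    simpa [Function.comp_def, Pi.single_apply, eq_comm] using this
  have h := ((hasDerivAt_time_line p (hg p.2).hasDerivAt (EuclideanSpace.single i 1) 0).mul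
    ((hasDerivAt_height_line y v s ρ p (EuclideanSpace.single i 1) 0).mul hd)).const_mul (-4)
  refine Eq.trans (HasDerivAt.deriv h) ?_
  split_ifs <;> simp [EuclideanSpace.inner_single_right] <;> ring

theorem parabolicOp_barrier {n : ℕ} (α : SpaceTime n → Matrix (Fin n) (Fin n) ℝ)
    (β : SpaceTime n → Fin n → ℝ) (y v : EuclideanSpace ℝ (Fin n)) (s ρ m : ℝ) {g : ℝ → ℝ}
    (hg : Differentiable ℝ g) (p : SpaceTime n) :
    parabolicOp α β (barrier y v s ρ m g) p =
      deriv g p.2 * (ρ ^ 2 - ‖displacement y v s p‖ ^ 2) ^ 2 +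
        g p.2 * (4 * (ρ ^ 2 - ‖displacement y v s p‖ ^ 2) *
            (inner ℝ (displacement y v s p) v + ∑ i, α p i i +
              ∑ i, β p i * displacement y v s p i) -
          8 * ∑ i, ∑ j, α p i j * displacement y v s p i * displacement y v s p j) := by
  simp only [parabolicOp, partialT_barrier y v s ρ m p (hg p.2).hasDerivAt,
    partialX_partialX_barrier y v s ρ m hg]
  simp only [partialX_barrier y v s ρ m hg]
  set d := displacement y v s p
  set w := ρ ^ 2 - ‖d‖ ^ 2
  have h1 : ∑ i, ∑ j, α p i j * (8 * g p.2 * (d i * d j) -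
      4 * g p.2 * w * (if i = j then 1 else 0)) =
      8 * g p.2 * (∑ i, ∑ j, α p i j * d i * d j) - 4 * g p.2 * w * ∑ i, α p i i := by
    simp only [Finset.mul_sum, ← Finset.sum_sub_distrib]
    refine Finset.sum_congr rfl fun i _ => ?_
    rw [show 4 * g p.2 * w * α p i i =
      ∑ j, 4 * g p.2 * w * (α p i j * if i = j then 1 else 0) by simp, ← Finset.sum_sub_distrib]
    exact Finset.sum_congr rfl fun j _ => by ring
  have h2 : ∑ i, β p i * (-4 * (g p.2 * (w * d i))) = -(4 * g p.2 * w) * ∑ i, β p i * d i := by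
    rw [Finset.mul_sum]
    exact Finset.sum_congr rfl fun i _ => by ring
  rw [h1, h2]
  ring

/-! ### The barrier as a strict subsolution -/

/-- Complete the square. In the application `-B` comes from ellipticity at the lateral boundary `w =
0`, and `κ` from the decay of the amplitude. -/
theorem exists_quadratic_neg (A : ℝ) {B : ℝ} (hB : 0 < B) :
    ∃ κ : ℝ, ∀ w : ℝ, -κ * w ^ 2 + A * w - B < 0 := by
  refine ⟨A ^ 2 / (2 * B), fun w => ?_⟩
  have h : -(A ^ 2 / (2 * B)) * w ^ 2 + A * w - B =
      -((A * w - B) ^ 2 / (2 * B)) - B / 2 := by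
    field_simp
    ring
  rw [h]
  have : 0 ≤ (A * w - B) ^ 2 / (2 * B) := by positivity
  linarith

/-- On a compact set, the barrier is a strict subsolution when its amplitude decays fast enough. -/
theorem exists_decay_rate {n : ℕ} {Ω : Set (SpaceTime n)}
    {α : SpaceTime n → Matrix (Fin n) (Fin n) ℝ} {β : SpaceTime n → Fin n → ℝ}
    {γ : SpaceTime n → ℝ}
    (hα : ∀ i j, LocallyBoundedIn Ω (fun p => α p i j))
    (hβ : ∀ i, LocallyBoundedIn Ω (fun p => β p i))
    (hγ : LocallyBoundedIn Ω γ) (hγ0 : ∀ p ∈ Ω, 0 ≤ γ p)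
    (hpos : LocallyUniformlyPosDefIn Ω α)
    {C : Set (SpaceTime n)} (hCΩ : C ⊆ Ω) (hC : IsCompact C)
    (y v : EuclideanSpace ℝ (Fin n)) (s : ℝ) {ρ : ℝ} (hρ : 0 < ρ) :
    ∃ κ : ℝ, ∀ (g : ℝ → ℝ) (m : ℝ), Differentiable ℝ g → m ≤ 0 → ∀ p ∈ C,
      ‖displacement y v s p‖ ≤ ρ → 0 < g p.2 → deriv g p.2 ≤ -κ * g p.2 →
      parabolicOp α β (barrier y v s ρ m g) p + γ p * barrier y v s ρ m g p < 0 := by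
  choose a ha using fun i => hα i i C hCΩ hC
  choose b hb using fun i => hβ i C hCΩ hC
  obtain ⟨M, hM⟩ := hγ C hCΩ hC
  obtain ⟨θ, hθ, hell⟩ := hpos C hCΩ hC
  set S := ρ * ‖v‖ + ∑ i, |a i| + ∑ i, |b i| * ρ with hS
  have hS0 : 0 ≤ S := by positivity
  -- These coefficients are those of `4wS - 8θ(ρ² - w)`, which bounds the drift and second-order
  -- terms per unit of `g`.
  obtain ⟨κ, hκ⟩ := exists_quadratic_neg (4 * S + 8 * θ)
    (show 0 < 8 * θ * ρ ^ 2 by positivity)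
  -- The extra decay `M` absorbs `γ g w²`; the remaining term `γ m` is nonpositive.
  refine ⟨κ + M, fun g m hg hm p hp hd hgp hg' => ?_⟩
  rw [parabolicOp_barrier α β y v s ρ m hg p, barrier]
  set d := displacement y v s p
  set w := ρ ^ 2 - ‖d‖ ^ 2 with hw
  have hw0 : 0 ≤ w := sub_nonneg.2 (pow_le_pow_left₀ (norm_nonneg _) hd 2)
  have hdi : ∀ i, |d i| ≤ ρ := fun i => (PiLp.norm_apply_le d i).trans hd
  have hdrift : inner ℝ d v + ∑ i, α p i i + ∑ i, β p i * d i ≤ S := by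
    refine add_le_add (add_le_add ?_ ?_) ?_
    · exact (real_inner_le_norm d v).trans (mul_le_mul_of_nonneg_right hd (norm_nonneg _))
    · exact Finset.sum_le_sum fun i _ =>
        (le_abs_self _).trans ((ha i p hp).trans (le_abs_self _))
    · refine Finset.sum_le_sum fun i _ => (le_abs_self _).trans ?_
      rw [abs_mul]
      exact mul_le_mul ((hb i p hp).trans (le_abs_self _)) (hdi i) (abs_nonneg _) (abs_nonneg _)
  have hquad : θ * (ρ ^ 2 - w) ≤ ∑ i, ∑ j, α p i j * d i * d j := by
    have h := hell p hp (fun i => d i)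
    rwa [← EuclideanSpace.real_norm_sq_eq, show ‖d‖ ^ 2 = ρ ^ 2 - w by rw [hw]; ring] at h
  have hγM : γ p ≤ M := (le_abs_self _).trans (hM p hp)
  have hγm : γ p * m ≤ 0 := mul_nonpos_of_nonneg_of_nonpos (hγ0 p (hCΩ hp)) hm
  have h1 : deriv g p.2 * w ^ 2 ≤ -(κ + M) * g p.2 * w ^ 2 :=
    mul_le_mul_of_nonneg_right hg' (sq_nonneg w)
  have h2 : g p.2 * (4 * w * (inner ℝ d v + ∑ i, α p i i + ∑ i, β p i * d i) -
      8 * ∑ i, ∑ j, α p i j * d i * d j) ≤ g p.2 * (4 * w * S - 8 * (θ * (ρ ^ 2 - w))) := by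
    gcongr
  have h3 : γ p * (g p.2 * w ^ 2) ≤ M * (g p.2 * w ^ 2) := by gcongr
  have h4 := mul_neg_of_pos_of_neg hgp (hκ w)
  linarith

/-! ### Propagation of positivity along a moving ball -/

/-- Positivity propagates forward in time along a tilted cylinder. -/
theorem pos_of_pos_at_earlier_time {n : ℕ} {X : Set (EuclideanSpace ℝ (Fin n))}
    {α : SpaceTime n → Matrix (Fin n) (Fin n) ℝ} {β : SpaceTime n → Fin n → ℝ}
    {γ : SpaceTime n → ℝ}
    (hα : ∀ i j, LocallyBoundedIn (cylinder X) (fun p => α p i j))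
    (hβ : ∀ i, LocallyBoundedIn (cylinder X) (fun p => β p i))
    (hγ : LocallyBoundedIn (cylinder X) γ)
    (hγ0 : ∀ p ∈ cylinder X, 0 ≤ γ p)
    (hpos : LocallyUniformlyPosDefIn (cylinder X) α)
    {f : SpaceTime n → ℝ}
    (hfc : ContinuousOn f (cylinder X))
    (hf0 : ∀ p ∈ cylinder X, 0 ≤ f p)
    (hf : IsViscositySupersolution (cylinder X) α β γ f)
    {y z : EuclideanSpace ℝ (Fin n)} {δ : ℝ} (hδ : 0 < δ) (hyz : ‖z - y‖ ≤ δ)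
    (hball : Metric.closedBall y (3 * δ) ⊆ X) {s t : ℝ} (hs : 0 < s) (hst : s < t)
    (hfy : 0 < f (y, s)) : 0 < f (z, t) := by
  -- Time runs past `t`, to `2t - s`, so that `g` can vanish at the end yet be positive at `t`. By
  -- then the centre has moved at most `2δ`, and `ρ ≤ δ`.
  set C : Set (SpaceTime n) := Metric.closedBall y (3 * δ) ×ˢ Set.Icc s (2 * t - s) with hCdef
  have hC : IsCompact C := (isCompact_closedBall _ _).prod isCompact_Icc
  have hCΩ : C ⊆ cylinder X := Set.prod_mono hball fun τ hτ => lt_of_lt_of_le hs hτ.1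
  have hyC : (y, s) ∈ C :=
    ⟨Metric.mem_closedBall_self (by positivity), le_refl s, by linarith⟩
  obtain ⟨r, hr, hrf⟩ : ∃ r > 0, ∀ x, ‖x - y‖ ≤ r → (x, s) ∈ C → f (y, s) / 2 < f (x, s) := by
    have h := (hfc.mono hCΩ (y, s) hyC).eventually (lt_mem_nhds (half_lt_self hfy))
    rw [eventually_nhdsWithin_iff, Metric.eventually_nhds_iff] at h
    obtain ⟨r, hr, h⟩ := h
    refine ⟨r / 2, by positivity, fun x hx => h ?_⟩
    rw [Prod.dist_eq, dist_self, dist_eq_norm]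
    exact max_lt (by linarith) hr
  set ρ := min r δ with hρdef
  have hρ : 0 < ρ := lt_min hr hδ
  set v := (t - s)⁻¹ • (z - y) with hv
  have hts : 0 < t - s := sub_pos.2 hst
  obtain ⟨κ, hκ⟩ := exists_decay_rate hα hβ hγ hγ0 hpos hCΩ hC y v s hρ
  have hdC : ∀ p : SpaceTime n, p.2 ∈ Set.Icc s (2 * t - s) → ‖displacement y v s p‖ ≤ ρ →
      p ∈ C := by
    intro p hp hd
    refine ⟨?_, hp⟩
    have hvb : ‖(p.2 - s) • v‖ ≤ 2 * δ := by
      have h2 : (p.2 - s) * (t - s)⁻¹ ≤ 2 := by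
        rw [← div_eq_mul_inv, div_le_iff₀ hts]
        linarith [hp.2]
      have h0 : 0 ≤ (p.2 - s) * (t - s)⁻¹ :=
        mul_nonneg (sub_nonneg.2 hp.1) (inv_nonneg.2 hts.le)
      rw [hv, smul_smul, norm_smul, Real.norm_of_nonneg h0]
      gcongr
    rw [Metric.mem_closedBall, dist_eq_norm]
    calc ‖p.1 - y‖ = ‖displacement y v s p + (p.2 - s) • v‖ := by simp [displacement]
      _ ≤ ‖displacement y v s p‖ + ‖(p.2 - s) • v‖ := norm_add_le _ _
      _ ≤ 3 * δ := by linarith [min_le_right r δ]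
  set D : Set (SpaceTime n) :=
    {p | p.2 ∈ Set.Icc s (2 * t - s) ∧ ‖displacement y v s p‖ ≤ ρ} with hDdef
  have hDC : D ⊆ C := fun p hp => hdC p hp.1 hp.2
  have hcd : Continuous (displacement y v s) := (contDiff_displacement y v s).continuous
  have hD : IsCompact D := hC.of_isClosed_subset
    ((isClosed_Icc.preimage continuous_snd).inter (isClosed_le hcd.norm continuous_const)) hDC
  -- Normalised so that the barrier's maximum at time `s` is `f (y, s) / 2`, which lies below `f` on
  -- the initial ball.
  set ε := f (y, s) / 2 / ((2 * t - s - s) * Real.exp (-κ * s) * ρ ^ 4) with hε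
  have hTs : 0 < 2 * t - s - s := by linarith
  have hε0 : 0 < ε := by positivity
  -- The linear factor excludes a minimum at the final time, so two-sided neighbourhoods suffice;
  -- being decreasing, it only helps the decay inequality.
  set g : ℝ → ℝ := fun τ => ε * ((2 * t - s - τ) * Real.exp (-κ * τ)) with hg
  have hgs : g s * ρ ^ 4 = f (y, s) / 2 := by
    rw [hg, hε]
    field_simp
  have hgc : ContDiff ℝ ∞ g := by
    rw [hg]
    fun_prop
  have hgd : ∀ τ, HasDerivAt g (ε * (-1 * Real.exp (-κ * τ) +
      (2 * t - s - τ) * (Real.exp (-κ * τ) * (-κ * 1)))) τ := fun τ =>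
    ((((hasDerivAt_id τ).const_sub (2 * t - s)).mul
      (((hasDerivAt_id τ).const_mul (-κ)).exp)).const_mul ε)
  have hg' : ∀ τ, deriv g τ ≤ -κ * g τ := by
    intro τ
    rw [(hgd τ).deriv, hg]
    have : 0 < ε * Real.exp (-κ * τ) := by positivity
    linarith
  have hgpos : ∀ τ, τ < 2 * t - s → 0 < g τ := fun τ hτ =>
    mul_pos hε0 (mul_pos (by linarith) (Real.exp_pos _))
  have hdyz : displacement y v s (z, t) = 0 := by
    simp [displacement, hv, smul_smul, mul_inv_cancel₀ hts.ne']
  have hdys : displacement y v s (y, s) = 0 := by simp [displacement]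
  have hmain : ∀ p ∈ D, barrier y v s ρ 0 g p ≤ f p := by
    have hcont : ContinuousOn (fun p => f p - barrier y v s ρ 0 g p) D :=
      (hfc.mono (hDC.trans hCΩ)).sub (contDiff_barrier y v s ρ 0 hgc).continuous.continuousOn
    obtain ⟨p, hpD, hmin⟩ := hD.exists_isMinOn
      ⟨(y, s), ⟨le_refl s, by linarith⟩, by rw [hdys, norm_zero]; exact hρ.le⟩ hcont
    set m := f p - barrier y v s ρ 0 g p with hm
    suffices hm0 : 0 ≤ m from fun q hq => by
      have := isMinOn_iff.1 hmin q hq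
      linarith
    by_contra! hm0
    have hpΩ := hCΩ (hDC hpD)
    have hfp := hf0 p hpΩ
    -- Since `f ≥ 0`, the unshifted barrier is positive at `p`, which rules out the top and the
    -- side.
    have hbp : f p < g p.2 * (ρ ^ 2 - ‖displacement y v s p‖ ^ 2) ^ 2 := by
      rw [hm, barrier] at hm0
      linarith
    have htop : p.2 < 2 * t - s := by
      refine lt_of_le_of_ne hpD.1.2 fun h => ?_
      rw [h] at hbp
      simp only [hg, sub_self, zero_mul, mul_zero] at hbp
      linarith
    have hside : ‖displacement y v s p‖ < ρ := by
      refine lt_of_le_of_ne hpD.2 fun h => ?_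
      rw [h, sub_self] at hbp
      simp only [ne_eq, OfNat.ofNat_ne_zero, not_false_eq_true, zero_pow, mul_zero] at hbp
      linarith
    have hbot : s < p.2 := by
      refine lt_of_le_of_ne hpD.1.1 fun h => ?_
      have hpe : (p.1, s) = p := Prod.ext rfl h
      have hpy : ‖p.1 - y‖ ≤ r := by
        have := hpD.2
        rw [displacement, ← h, sub_self, zero_smul, sub_zero] at this
        exact this.trans (min_le_left _ _)
      have h1 := hrf p.1 hpy (by rw [hpe]; exact hDC hpD)
      rw [hpe, ← hgs] at h1
      rw [← h] at hbp
      have h2 : (ρ ^ 2 - ‖displacement y v s p‖ ^ 2) ^ 2 ≤ ρ ^ 4 := by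
        rw [show ρ ^ 4 = (ρ ^ 2) ^ 2 by ring]
        refine pow_le_pow_left₀ (sub_nonneg.2 (pow_le_pow_left₀ (norm_nonneg _) hside.le 2)) ?_ 2
        linarith [sq_nonneg ‖displacement y v s p‖]
      have h3 := mul_le_mul_of_nonneg_left h2 (hgpos s (by linarith)).le
      linarith
    have htouch : TouchesFromBelow (barrier y v s ρ m g) f p := by
      refine ⟨by simp only [hm, barrier]; ring, ?_⟩
      have hopen : ∀ᶠ q in 𝓝 p, q ∈ D := by
        have e1 := continuous_snd.continuousAt.eventually_mem (Ioo_mem_nhds hbot htop)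
        have e2 := hcd.norm.continuousAt.eventually_lt continuousAt_const hside
        filter_upwards [e1, e2] with q hq1 hq2
        exact ⟨⟨hq1.1.le, hq1.2.le⟩, hq2.le⟩
      filter_upwards [hopen] with q hq
      have := isMinOn_iff.1 hmin q hq
      simp only [barrier] at this hm ⊢
      linarith
    have h1 := hf _ (contDiff_barrier y v s ρ m hgc).contDiffOn p hpΩ htouch
    have h2 := hκ g m (hgc.differentiable (by simp)) hm0.le p (hDC hpD) hpD.2
      (hgpos _ htop) (hg' _)
    linarith
  have hz := hmain (z, t) ⟨⟨hst.le, by simp only; linarith⟩, by rw [hdyz, norm_zero]; exact hρ.le⟩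
  refine lt_of_lt_of_le ?_ hz
  rw [barrier, hdyz, norm_zero]
  have := hgpos t (by linarith)
  simp only [zero_pow two_ne_zero, sub_zero, add_zero]
  positivity

/-! ### Chaining through `X` and passage to the closure -/

theorem mainTheorem3 {n : ℕ} (X : Set (EuclideanSpace ℝ (Fin n)))
    (hXo : IsOpen X) (hXc : IsConnected X)
    (α : SpaceTime n → Matrix (Fin n) (Fin n) ℝ) (β : SpaceTime n → Fin n → ℝ)
    (γ : SpaceTime n → ℝ)
    (hα : ∀ i j, LocallyBoundedIn (cylinder X) (fun p => α p i j))
    (hβ : ∀ i, LocallyBoundedIn (cylinder X) (fun p => β p i))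
    (hγ : LocallyBoundedIn (cylinder X) γ)
    (hγ0 : ∀ p ∈ cylinder X, 0 ≤ γ p)
    (hpos : LocallyUniformlyPosDefIn (cylinder X) α)
    (f : SpaceTime n → ℝ)
    (hfc : ContinuousOn f (closure (cylinder X)))
    (hf0 : ∀ p ∈ closure (cylinder X), 0 ≤ f p)
    (hf : IsViscositySupersolution (cylinder X) α β γ f)
    (x₀ : EuclideanSpace ℝ (Fin n)) (t₀ : ℝ) (h₀ : (x₀, t₀) ∈ cylinder X)
    (hzero : f (x₀, t₀) = 0) :
    ∀ x t, (x, t) ∈ closure (cylinder X) → t ≤ t₀ → f (x, t) = 0 := by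
  have hprop : ∀ {y z : EuclideanSpace ℝ (Fin n)} {δ : ℝ}, 0 < δ → ‖z - y‖ ≤ δ →
      Metric.closedBall y (3 * δ) ⊆ X → ∀ s t : ℝ, 0 < s → s < t → 0 < f (y, s) →
      0 < f (z, t) := fun hδ hyz hball _ _ hs hst =>
    pos_of_pos_at_earlier_time hα hβ hγ hγ0 hpos (hfc.mono subset_closure)
      (fun p hp => hf0 p (subset_closure hp)) hf hδ hyz hball hs hst
  have hchain : ∀ y ∈ X, ∀ z ∈ X, ∀ s t : ℝ, 0 < s → s < t → 0 < f (y, s) → 0 < f (z, t) := by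
    intro y hy z hz
    -- The local relation is needed in both directions: the `3R/4`-ball about a point within `R/4`
    -- of `a` still lies in the `R`-ball about `a`. Transitivity passes through the midpoint time.
    refine hXc.isPreconnected.induction₂'
      (fun y z => ∀ s t : ℝ, 0 < s → s < t → 0 < f (y, s) → 0 < f (z, t)) ?_ ?_ hy hz
    · intro a ha
      obtain ⟨R, hR, hRX⟩ := Metric.nhds_basis_closedBall.mem_iff.1 (hXo.mem_nhds ha)
      refine eventually_nhdsWithin_of_eventually_nhds ?_
      filter_upwards [Metric.closedBall_mem_nhds a (show 0 < R / 4 by positivity)] with b hb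
      have hb' : ‖b - a‖ ≤ R / 4 := by rwa [← dist_eq_norm]
      refine ⟨hprop (δ := R / 4) (by positivity) hb' ?_,
        hprop (δ := R / 4) (by positivity) (by rwa [norm_sub_rev]) ?_⟩
      · exact (Metric.closedBall_subset_closedBall (by linarith)).trans hRX
      · refine (Metric.closedBall_subset_closedBall' ?_).trans hRX
        rw [dist_eq_norm]
        linarith
    · intro a b c _ _ _ hab hbc s t hs hst hfa
      exact hbc ((s + t) / 2) t (by linarith) (by linarith)
        (hab s ((s + t) / 2) hs (by linarith) hfa)
  intro x t hxt ht
  by_contra hne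
  have hfpos : 0 < f (x, t) := lt_of_le_of_ne (hf0 _ hxt) (Ne.symm hne)
  have ht₀ : 0 < t₀ := h₀.2
  -- Approximating from times strictly between `0` and `t₀` covers `t = 0`, `t = t₀` and boundary
  -- points `x` at once.
  have hmem : (x, t) ∈ closure (X ×ˢ Set.Ioo 0 t₀) := by
    rw [cylinder, closure_prod_eq, closure_Ioi] at hxt
    rw [closure_prod_eq, closure_Ioo ht₀.ne]
    exact ⟨hxt.1, hxt.2, ht⟩
  have hev := (hfc _ hxt).eventually (lt_mem_nhds hfpos)
  rw [eventually_nhdsWithin_iff] at hev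
  obtain ⟨q, hq, hqX⟩ := (mem_closure_iff_frequently.1 hmem).and_eventually hev |>.exists
  have hqpos := hqX (subset_closure ⟨hq.1, hq.2.1⟩)
  have := hchain q.1 hq.1 x₀ h₀.1 q.2 t₀ hq.2.1 hq.2.2 hqpos
  linarith
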